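/- **Theorem (Soundness and completeness of MPDBL4).** An s-hypersequent is provable in $\mathbf{MPDBL4}$ if and only if it is valid in the class of all reflexive and transitive Kripke contexts. Here the notions are as follows. *Syntax.* Let $\mathbf{OV}$ (object variables) and $\mathbf{PV}$ (property variables) be disjoint countably infinite sets. Formulae are given by $$\top\mid\bot\mid p\mid P\mid\alpha\sqcup\beta\mid\alpha\sqcap\beta\mid\neg\alpha\mid\lrcorner\alpha\mid\square\alpha\mid\blacksquare\alpha\qquad(p\in\mathbf{OV},\ P\in\mathbf{PV}),$$ with $\alpha\vee\beta:=\neg(\neg\alpha\sqcap\neg\beta)$ and $\alpha\wedge\beta:=\lrcorner(\lrcorner\alpha\sqcup\lrcorner\beta)$. A sequent is a pair $\alpha\vdash\beta$ of formulae; an s-hypersequent is a finite, possibly empty, sequence $\alpha_1\vdash\beta_1\mid\dots\mid\alpha_n\vdash\beta_n$ of sequents (its components). $\alpha\dashv\vdash\beta$ stands for the two sequents $\alpha\vdash\beta$ and $\beta\vdash\alpha$. *The calculus $\mathbf{MPDBL4}$.* Axioms, for all formulae $\alpha,\beta,\gamma$ and all $p\in\mathbf{OV}$, $P\in\mathbf{PV}$: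 * $\alpha\vdash\alpha$; $\ \alpha\sqcap\beta\vdash\alpha$; $\ \alpha\vdash\alpha\sqcup\beta$; $\ \alpha\sqcap\beta\vdash\beta$; $\ \beta\vdash\alpha\sqcup\beta$; * $\alpha\sqcap\beta\vdash(\alpha\sqcap\beta)\sqcap(\alpha\sqcap\beta)$; $\ (\alpha\sqcup\beta)\sqcup(\alpha\sqcup\beta)\vdash\alpha\sqcup\beta$; * $\neg(\alpha\sqcap\alpha)\vdash\neg\alpha$; $\ \lrcorner\alpha\vdash\lrcorner(\alpha\sqcup\alpha)$; $\ \alpha\sqcap\neg\alpha\vdash\bot$; $\ \top\vdash\alpha\sqcup\lrcorner\alpha$; * $\neg\neg(\alpha\sqcap\beta)\dashv\vdash\alpha\sqcap\beta$; $\ \lrcorner\lrcorner(\alpha\sqcup\beta)\dashv\vdash\alpha\sqcup\beta$; * $\alpha\sqcap\alpha\vdash\alpha\sqcap(\alpha\sqcup\beta)$; $\ \alpha\sqcup(\alpha\sqcap\beta)\vdash\alpha\sqcup\alpha$; $\ \alpha\sqcap\alpha\vdash\alpha\sqcap(\alpha\vee\beta)$; $\ \alpha\sqcup(\alpha\wedge\beta)\vdash\alpha\sqcup\alpha$;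 * $\alpha\sqcap(\beta\vee\gamma)\dashv\vdash(\alpha\sqcap\beta)\vee(\alpha\sqcap\gamma)$; $\ \alpha\sqcup(\beta\wedge\gamma)\dashv\vdash(\alpha\sqcup\beta)\wedge(\alpha\sqcup\gamma)$; * $\bot\vdash\alpha$; $\ \alpha\vdash\top$; $\ \neg\top\vdash\bot$; $\ \top\vdash\lrcorner\bot$; $\ \neg\bot\dashv\vdash\top\sqcap\top$; $\ \lrcorner\top\dashv\vdash\bot\sqcup\bot$; * $(\alpha\sqcup\alpha)\sqcap(\alpha\sqcup\alpha)\dashv\vdash(\alpha\sqcap\alpha)\sqcup(\alpha\sqcap\alpha)$; $\ p\sqcap p\dashv\vdash p$; $\ P\sqcup P\dashv\vdash P$; * $\square\alpha\sqcap\square\beta\dashv\vdash\square(\alpha\sqcap\beta)$; $\ \blacksquare\alpha\sqcup\blacksquare\beta\dashv\vdash\blacksquare(\alpha\sqcup\beta)$; $\ \square\neg\bot\dashv\vdash\neg\bot$; $\ \blacksquare\lrcorner\top\dashv\vdash\lrcorner\top$; $\ \square(\alpha\sqcap\alpha)\dashv\vdash\square\alpha$; $\ \blacksquare(\alpha\sqcup\alpha)\dashv\vdash\blacksquare\alpha$;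 * $\square\alpha\vdash\alpha$; $\ \alpha\vdash\blacksquare\alpha$; $\ \square\square\alpha\dashv\vdash\square\alpha$; $\ \blacksquare\blacksquare\alpha\dashv\vdash\blacksquare\alpha$. Rules ($B,C,D,E,F,G,H,X$ possibly empty s-hypersequents): * from $B\mid\alpha\vdash\beta\mid C$ infer $B\mid\sigma\mid C$, where $\sigma$ is any of $\alpha\sqcap\gamma\vdash\beta\sqcap\gamma$, $\ \gamma\sqcap\alpha\vdash\gamma\sqcap\beta$, $\ \alpha\sqcup\gamma\vdash\beta\sqcup\gamma$, $\ \gamma\sqcup\alpha\vdash\gamma\sqcup\beta$, $\ \neg\beta\vdash\neg\alpha$, $\ \lrcorner\beta\vdash\lrcorner\alpha$, $\ \square\alpha\vdash\square\beta$, $\ \blacksquare\alpha\vdash\blacksquare\beta$; * from $B\mid\alpha\vdash\beta\mid C$ and $D\mid\beta\vdash\gamma\mid E$ infer $B\mid D\mid\alpha\vdash\gamma\mid C\mid E$; * infer, without premises, $\alpha\vdash\alpha\sqcap\alpha\mid\alpha\sqcup\alpha\vdash\alpha$; * from $B\mid\alpha\sqcap\beta\vdash\alpha\sqcap\alpha\mid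 C$, $\ D\mid\alpha\sqcap\alpha\vdash\alpha\sqcap\beta\mid E$, $\ F\mid\alpha\sqcup\beta\vdash\beta\sqcup\beta\mid G$ and $H\mid\beta\sqcup\beta\vdash\alpha\sqcup\beta\mid X$ infer $B\mid D\mid F\mid H\mid\alpha\vdash\beta\mid C\mid E\mid G\mid X$; * from $B\mid D\mid D\mid C$ infer $B\mid D\mid C$; from $B\mid D\mid E\mid C$ infer $B\mid E\mid D\mid C$; from $B$ infer $B\mid C$. *Semantics.* A context is a triple $\mathbb K=(G,M,I)$ of sets $G,M$ and a relation $I\subseteq G\times M$. For $A\subseteq G$ and $B\subseteq M$ let $A'=\{m\in M:gIm\text{ for all }g\in A\}$ and $B'=\{g\in G:gIm\text{ for all }m\in B\}$. A semiconcept is a pair $(A,B)$ with $A'=B$ or $B'=A$; put $ext(A,B)=A$, $int(A,B)=B$, $(A_1,B_1)\sqcap(A_2,B_2)=(A_1\cap A_2,(A_1\cap A_2)')$ and $(A_1,B_1)\sqcup(A_2,B_2)=((B_1\cap B_2)',B_1\cap B_2)$. A Kripke context is $\mathbb{KC}=((G,R),(M,S),I)$ with $(G,M,I)$ a context, $R\subseteq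 G\times G$ and $S\subseteq M\times M$; it is reflexive (transitive) if both $R$ and $S$ are. A model $\mathbb M$ based on $\mathbb{KC}$ is a map $v$ from variables to semiconcepts of $(G,M,I)$ with $v(p)\sqcap v(p)=v(p)$ for $p\in\mathbf{OV}$ and $v(P)\sqcup v(P)=v(P)$ for $P\in\mathbf{PV}$. Satisfaction $g\models\alpha$ ($g\in G$) and co-satisfaction $m\succ\alpha$ ($m\in M$) are defined recursively: * for a variable $x$: $g\models x$ iff $g\in ext(v(x))$, and $m\succ x$ iff $m\in int(v(x))$; * always $g\models\top$ and $m\not\succ\top$; always $g\not\models\bot$ and $m\succ\bot$; * $g\models\alpha\sqcap\beta$ iff $g\models\alpha$ and $g\models\beta$; $\ m\succ\alpha\sqcap\beta$ iff $gIm$ for all $g$ with $g\models\alpha\sqcap\beta$; * $m\succ\alpha\sqcup\beta$ iff $m\succ\alpha$ and $m\succ\beta$; $\ g\models\alpha\sqcup\beta$ iff $gIm$ for all $m$ with $m\succ\alpha\sqcup\beta$; * $g\models\neg\alpha$ iff $g\not\models\alpha$; $\ m\succ\neg\alpha$ iff $gIm$ for all $g$ with $g\not\models\alpha$; * $m\succ\lrcorner\alpha$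 iff $m\not\succ\alpha$; $\ g\models\lrcorner\alpha$ iff $gIm$ for all $m$ with $m\not\succ\alpha$; * $g\models\square\alpha$ iff $g_1\models\alpha$ for all $g_1$ with $gRg_1$; $\ m\succ\square\alpha$ iff $gIm$ for all $g$ with $g\models\square\alpha$; * $m\succ\blacksquare\alpha$ iff $m_1\succ\alpha$ for all $m_1$ with $mSm_1$; $\ g\models\blacksquare\alpha$ iff $gIm$ for all $m$ with $m\succ\blacksquare\alpha$. A sequent $\alpha\vdash\beta$ is satisfied in $\mathbb M$ if $g\models\alpha$ implies $g\models\beta$ for all $g\in G$ and $m\succ\beta$ implies $m\succ\alpha$ for all $m\in M$. An s-hypersequent is satisfied in $\mathbb M$ if at least one of its components is; it is valid in a class of Kripke contexts if it is satisfied in every model based on a Kripke context of the class. -/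

import Mathlib

universe u v

namespace MPDBL

/-! ### Contexts, semiconcepts, Kripke contexts -/

/-- A context (polarity): objects, properties and an incidence relation between them. -/
structure Context where
  Obj : Type u
  Prp : Type v
  inc : Obj → Prp → Prop

/-- A semiconcept of a context: a pair `(A, B)` with `A′ = B` or `B′ = A`. Here `A′` is
`upperPolar K.inc A` and `B′` is `lowerPolar K.inc B`. -/
@[ext]
structure Semiconcept (K : Context.{u, v}) where
  extent : Set K.Obj
  intent : Set K.Prp
  polar_or : upperPolar K.inc extent = intent ∨ lowerPolar K.inc intent = extent

/-- `(A₁, B₁) ⊓ (A₂, B₂) = (A₁ ∩ A₂, (A₁ ∩ A₂)′)`. -/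
def Semiconcept.meet {K : Context.{u, v}} (x y : Semiconcept K) : Semiconcept K where
  extent := x.extent ∩ y.extent
  intent := upperPolar K.inc (x.extent ∩ y.extent)
  polar_or := Or.inl rfl

/-- `(A₁, B₁) ⊔ (A₂, B₂) = ((B₁ ∩ B₂)′, B₁ ∩ B₂)`. -/
def Semiconcept.join {K : Context.{u, v}} (x y : Semiconcept K) : Semiconcept K where
  extent := lowerPolar K.inc (x.intent ∩ y.intent)
  intent := x.intent ∩ y.intent
  polar_or := Or.inr rfl

/-- Left semiconcepts: the idempotents of `⊓`. -/
def Semiconcept.IsLeft {K : Context.{u, v}} (x : Semiconcept K) : Prop := x.meet x = x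

/-- Right semiconcepts: the idempotents of `⊔`. -/
def Semiconcept.IsRight {K : Context.{u, v}} (x : Semiconcept K) : Prop := x.join x = x

/-- A Kripke context `((G, R), (M, S), I)`: a context together with a relation on its objects and
a relation on its properties. -/
structure KripkeContext extends Context.{u, v} where
  R : Obj → Obj → Prop
  S : Prp → Prp → Prop

/-- A Kripke context is reflexive if both of its relations are. -/
def KripkeContext.IsReflexive (K : KripkeContext.{u, v}) : Prop :=
  (∀ g, K.R g g) ∧ (∀ m, K.S m m)

/-- A Kripke context is transitive if both of its relations are. -/
def KripkeContext.IsTransitive (K : KripkeContext.{u, v}) : Prop :=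
  (∀ g₁ g₂ g₃, K.R g₁ g₂ → K.R g₂ g₃ → K.R g₁ g₃) ∧
    (∀ m₁ m₂ m₃, K.S m₁ m₂ → K.S m₂ m₃ → K.S m₁ m₃)

/-! ### Formulae, sequents, s-hypersequents -/

/-- Formulae of the modal language. Object variables and property variables are two disjoint
countably infinite families, each indexed by the natural numbers. -/
inductive Formula where
  | top : Formula
  | bot : Formula
  | ov : ℕ → Formula
  | pv : ℕ → Formula
  | join : Formula → Formula → Formula
  | meet : Formula → Formula → Formula
  | neg : Formula → Formula
  | opp : Formula → Formula
  | box : Formula → Formula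
  | bbox : Formula → Formula

notation "⊤ᶠ" => Formula.top
notation "⊥ᶠ" => Formula.bot
infixl:70 " ⊓ᶠ " => Formula.meet
infixl:69 " ⊔ᶠ " => Formula.join
prefix:75 "¬ᶠ" => Formula.neg
prefix:75 "⌟ᶠ" => Formula.opp
prefix:75 "□ᶠ" => Formula.box
prefix:75 "■ᶠ" => Formula.bbox

/-- The defined connective `α ∨ β := ¬(¬α ⊓ ¬β)`. -/
def Formula.vee (α β : Formula) : Formula := ¬ᶠ(¬ᶠα ⊓ᶠ ¬ᶠβ)

/-- The defined connective `α ∧ β := ⌟(⌟α ⊔ ⌟β)`. -/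
def Formula.wedge (α β : Formula) : Formula := ⌟ᶠ(⌟ᶠα ⊔ᶠ ⌟ᶠβ)

infixl:68 " ∨ᶠ " => Formula.vee
infixl:68 " ∧ᶠ " => Formula.wedge

/-- A sequent `α ⊢ β` is a pair of formulae. -/
structure Sequent where
  lhs : Formula
  rhs : Formula

infix:50 " ⊢ˢ " => Sequent.mk

/-- An s-hypersequent: a finite (possibly empty) sequence of sequents. -/
abbrev SHypersequent := List Sequent

/-! ### The calculi -/

/-- Axiom schemes of the propositional part, over all formulae of the modal language. A scheme
with `⊣⊢` is split into its two directions `l` (left to right) and `r` (right to left). -/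
inductive PropAx : Sequent → Prop
  | a1 (α : Formula) : PropAx (α ⊢ˢ α)
  | a2a (α β : Formula) : PropAx (α ⊓ᶠ β ⊢ˢ α)
  | a2b (α β : Formula) : PropAx (α ⊢ˢ α ⊔ᶠ β)
  | a3a (α β : Formula) : PropAx (α ⊓ᶠ β ⊢ˢ β)
  | a3b (α β : Formula) : PropAx (β ⊢ˢ α ⊔ᶠ β)
  | a4a (α β : Formula) : PropAx (α ⊓ᶠ β ⊢ˢ (α ⊓ᶠ β) ⊓ᶠ (α ⊓ᶠ β))
  | a4b (α β : Formula) : PropAx ((α ⊔ᶠ β) ⊔ᶠ (α ⊔ᶠ β) ⊢ˢ α ⊔ᶠ β)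
  | a5a (α : Formula) : PropAx (¬ᶠ(α ⊓ᶠ α) ⊢ˢ ¬ᶠα)
  | a5b (α : Formula) : PropAx (⌟ᶠα ⊢ˢ ⌟ᶠ(α ⊔ᶠ α))
  | a6a (α : Formula) : PropAx (α ⊓ᶠ ¬ᶠα ⊢ˢ ⊥ᶠ)
  | a6b (α : Formula) : PropAx (⊤ᶠ ⊢ˢ α ⊔ᶠ ⌟ᶠα)
  | a7al (α β : Formula) : PropAx (¬ᶠ(¬ᶠ(α ⊓ᶠ β)) ⊢ˢ α ⊓ᶠ β)
  | a7ar (α β : Formula) : PropAx (α ⊓ᶠ β ⊢ˢ ¬ᶠ(¬ᶠ(α ⊓ᶠ β)))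
  | a7bl (α β : Formula) : PropAx (⌟ᶠ(⌟ᶠ(α ⊔ᶠ β)) ⊢ˢ α ⊔ᶠ β)
  | a7br (α β : Formula) : PropAx (α ⊔ᶠ β ⊢ˢ ⌟ᶠ(⌟ᶠ(α ⊔ᶠ β)))
  | a8a (α β : Formula) : PropAx (α ⊓ᶠ α ⊢ˢ α ⊓ᶠ (α ⊔ᶠ β))
  | a8b (α β : Formula) : PropAx (α ⊔ᶠ (α ⊓ᶠ β) ⊢ˢ α ⊔ᶠ α)
  | a9a (α β : Formula) : PropAx (α ⊓ᶠ α ⊢ˢ α ⊓ᶠ (α ∨ᶠ β))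
  | a9b (α β : Formula) : PropAx (α ⊔ᶠ (α ∧ᶠ β) ⊢ˢ α ⊔ᶠ α)
  | a10al (α β γ : Formula) : PropAx (α ⊓ᶠ (β ∨ᶠ γ) ⊢ˢ (α ⊓ᶠ β) ∨ᶠ (α ⊓ᶠ γ))
  | a10ar (α β γ : Formula) : PropAx ((α ⊓ᶠ β) ∨ᶠ (α ⊓ᶠ γ) ⊢ˢ α ⊓ᶠ (β ∨ᶠ γ))
  | a10bl (α β γ : Formula) : PropAx (α ⊔ᶠ (β ∧ᶠ γ) ⊢ˢ (α ⊔ᶠ β) ∧ᶠ (α ⊔ᶠ γ))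
  | a10br (α β γ : Formula) : PropAx ((α ⊔ᶠ β) ∧ᶠ (α ⊔ᶠ γ) ⊢ˢ α ⊔ᶠ (β ∧ᶠ γ))
  | a11a (α : Formula) : PropAx (⊥ᶠ ⊢ˢ α)
  | a11b (α : Formula) : PropAx (α ⊢ˢ ⊤ᶠ)
  | a12a : PropAx (¬ᶠ⊤ᶠ ⊢ˢ ⊥ᶠ)
  | a12b : PropAx (⊤ᶠ ⊢ˢ ⌟ᶠ⊥ᶠ)
  | a13al : PropAx (¬ᶠ⊥ᶠ ⊢ˢ ⊤ᶠ ⊓ᶠ ⊤ᶠ)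
  | a13ar : PropAx (⊤ᶠ ⊓ᶠ ⊤ᶠ ⊢ˢ ¬ᶠ⊥ᶠ)
  | a13bl : PropAx (⌟ᶠ⊤ᶠ ⊢ˢ ⊥ᶠ ⊔ᶠ ⊥ᶠ)
  | a13br : PropAx (⊥ᶠ ⊔ᶠ ⊥ᶠ ⊢ˢ ⌟ᶠ⊤ᶠ)
  | a14l (α : Formula) : PropAx ((α ⊔ᶠ α) ⊓ᶠ (α ⊔ᶠ α) ⊢ˢ (α ⊓ᶠ α) ⊔ᶠ (α ⊓ᶠ α))
  | a14r (α : Formula) : PropAx ((α ⊓ᶠ α) ⊔ᶠ (α ⊓ᶠ α) ⊢ˢ (α ⊔ᶠ α) ⊓ᶠ (α ⊔ᶠ α))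
  | a15al (p : ℕ) : PropAx (.ov p ⊓ᶠ .ov p ⊢ˢ .ov p)
  | a15ar (p : ℕ) : PropAx (.ov p ⊢ˢ .ov p ⊓ᶠ .ov p)
  | a15bl (P : ℕ) : PropAx (.pv P ⊔ᶠ .pv P ⊢ˢ .pv P)
  | a15br (P : ℕ) : PropAx (.pv P ⊢ˢ .pv P ⊔ᶠ .pv P)

/-- Modal axiom schemes of MPDBL. -/
inductive ModalAx : Sequent → Prop
  | a16al (α β : Formula) : ModalAx (□ᶠα ⊓ᶠ □ᶠβ ⊢ˢ □ᶠ(α ⊓ᶠ β))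
  | a16ar (α β : Formula) : ModalAx (□ᶠ(α ⊓ᶠ β) ⊢ˢ □ᶠα ⊓ᶠ □ᶠβ)
  | a16bl (α β : Formula) : ModalAx (■ᶠα ⊔ᶠ ■ᶠβ ⊢ˢ ■ᶠ(α ⊔ᶠ β))
  | a16br (α β : Formula) : ModalAx (■ᶠ(α ⊔ᶠ β) ⊢ˢ ■ᶠα ⊔ᶠ ■ᶠβ)
  | a17al : ModalAx (□ᶠ(¬ᶠ⊥ᶠ) ⊢ˢ ¬ᶠ⊥ᶠ)
  | a17ar : ModalAx (¬ᶠ⊥ᶠ ⊢ˢ □ᶠ(¬ᶠ⊥ᶠ))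
  | a17bl : ModalAx (■ᶠ(⌟ᶠ⊤ᶠ) ⊢ˢ ⌟ᶠ⊤ᶠ)
  | a17br : ModalAx (⌟ᶠ⊤ᶠ ⊢ˢ ■ᶠ(⌟ᶠ⊤ᶠ))
  | a18al (α : Formula) : ModalAx (□ᶠ(α ⊓ᶠ α) ⊢ˢ □ᶠα)
  | a18ar (α : Formula) : ModalAx (□ᶠα ⊢ˢ □ᶠ(α ⊓ᶠ α))
  | a18bl (α : Formula) : ModalAx (■ᶠ(α ⊔ᶠ α) ⊢ˢ ■ᶠα)
  | a18br (α : Formula) : ModalAx (■ᶠα ⊢ˢ ■ᶠ(α ⊔ᶠ α))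

/-- The additional axiom schemes of MPDBL4. -/
inductive FourAx : Sequent → Prop
  | a19a (α : Formula) : FourAx (□ᶠα ⊢ˢ α)
  | a19b (α : Formula) : FourAx (α ⊢ˢ ■ᶠα)
  | a20al (α : Formula) : FourAx (□ᶠ(□ᶠα) ⊢ˢ □ᶠα)
  | a20ar (α : Formula) : FourAx (□ᶠα ⊢ˢ □ᶠ(□ᶠα))
  | a20bl (α : Formula) : FourAx (■ᶠ(■ᶠα) ⊢ˢ ■ᶠα)
  | a20br (α : Formula) : FourAx (■ᶠα ⊢ˢ ■ᶠ(■ᶠα))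

/-- `Provable T G`: the s-hypersequent `G` is derivable in the logic obtained from MPDBL by adding
the sequents in `T` as axioms. -/
inductive Provable (T : Sequent → Prop) : SHypersequent → Prop
  | propAx {s : Sequent} (h : PropAx s) : Provable T [s]
  | modalAx {s : Sequent} (h : ModalAx s) : Provable T [s]
  | extraAx {s : Sequent} (h : T s) : Provable T [s]
  | r1 {B C : SHypersequent} {α β : Formula} (γ : Formula)
      (h : Provable T (B ++ [α ⊢ˢ β] ++ C)) :
      Provable T (B ++ [α ⊓ᶠ γ ⊢ˢ β ⊓ᶠ γ] ++ C)
  | r1' {B C : SHypersequent} {α β : Formula} (γ : Formula)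
      (h : Provable T (B ++ [α ⊢ˢ β] ++ C)) :
      Provable T (B ++ [γ ⊓ᶠ α ⊢ˢ γ ⊓ᶠ β] ++ C)
  | r2 {B C : SHypersequent} {α β : Formula} (γ : Formula)
      (h : Provable T (B ++ [α ⊢ˢ β] ++ C)) :
      Provable T (B ++ [α ⊔ᶠ γ ⊢ˢ β ⊔ᶠ γ] ++ C)
  | r2' {B C : SHypersequent} {α β : Formula} (γ : Formula)
      (h : Provable T (B ++ [α ⊢ˢ β] ++ C)) :
      Provable T (B ++ [γ ⊔ᶠ α ⊢ˢ γ ⊔ᶠ β] ++ C)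
  | r3 {B C : SHypersequent} {α β : Formula}
      (h : Provable T (B ++ [α ⊢ˢ β] ++ C)) :
      Provable T (B ++ [¬ᶠβ ⊢ˢ ¬ᶠα] ++ C)
  | r3' {B C : SHypersequent} {α β : Formula}
      (h : Provable T (B ++ [α ⊢ˢ β] ++ C)) :
      Provable T (B ++ [⌟ᶠβ ⊢ˢ ⌟ᶠα] ++ C)
  | r4 {B C D E : SHypersequent} {α β γ : Formula}
      (h₁ : Provable T (B ++ [α ⊢ˢ β] ++ C))
      (h₂ : Provable T (D ++ [β ⊢ˢ γ] ++ E)) :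
      Provable T (B ++ D ++ [α ⊢ˢ γ] ++ C ++ E)
  | sp (α : Formula) : Provable T [α ⊢ˢ α ⊓ᶠ α, α ⊔ᶠ α ⊢ˢ α]
  | r5 {B C D E F G H X : SHypersequent} {α β : Formula}
      (h₁ : Provable T (B ++ [α ⊓ᶠ β ⊢ˢ α ⊓ᶠ α] ++ C))
      (h₂ : Provable T (D ++ [α ⊓ᶠ α ⊢ˢ α ⊓ᶠ β] ++ E))
      (h₃ : Provable T (F ++ [α ⊔ᶠ β ⊢ˢ β ⊔ᶠ β] ++ G))
      (h₄ : Provable T (H ++ [β ⊔ᶠ β ⊢ˢ α ⊔ᶠ β] ++ X)) :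
      Provable T (B ++ D ++ F ++ H ++ [α ⊢ˢ β] ++ C ++ E ++ G ++ X)
  | r8 {B C : SHypersequent} {α β : Formula}
      (h : Provable T (B ++ [α ⊢ˢ β] ++ C)) :
      Provable T (B ++ [□ᶠα ⊢ˢ □ᶠβ] ++ C)
  | r9 {B C : SHypersequent} {α β : Formula}
      (h : Provable T (B ++ [α ⊢ˢ β] ++ C)) :
      Provable T (B ++ [■ᶠα ⊢ˢ ■ᶠβ] ++ C)
  | ec {B C D : SHypersequent} (h : Provable T (B ++ D ++ D ++ C)) :
      Provable T (B ++ D ++ C)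
  | ee {B C D E : SHypersequent} (h : Provable T (B ++ D ++ E ++ C)) :
      Provable T (B ++ E ++ D ++ C)
  | ew {B C : SHypersequent} (h : Provable T B) : Provable T (B ++ C)

/-- Provability in MPDBL4. -/
def ProvableMPDBL4 (G : SHypersequent) : Prop := Provable FourAx G

/-! ### Relational semantics -/

/-- A model based on a Kripke context: a valuation that sends object variables to left
semiconcepts and property variables to right semiconcepts. (A valuation has no choice on the
constants: they are treated in the satisfaction clauses.) -/
structure Model (K : KripkeContext.{u, v}) where
  ov : ℕ → Semiconcept K.toContext
  pv : ℕ → Semiconcept K.toContext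
  ov_isLeft : ∀ p, (ov p).IsLeft
  pv_isRight : ∀ P, (pv P).IsRight

/-- Satisfaction at objects (`Sum.inl g`) and co-satisfaction at properties (`Sum.inr m`), defined
simultaneously by recursion on the formula. -/
def Model.holds {K : KripkeContext.{u, v}} (𝔐 : Model K) : Formula → K.Obj ⊕ K.Prp → Prop
  | .top, .inl _ => True
  | .top, .inr _ => False
  | .bot, .inl _ => False
  | .bot, .inr _ => True
  | .ov p, .inl g => g ∈ (𝔐.ov p).extent
  | .ov p, .inr m => m ∈ (𝔐.ov p).intent
  | .pv P, .inl g => g ∈ (𝔐.pv P).extent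
  | .pv P, .inr m => m ∈ (𝔐.pv P).intent
  | .meet α β, .inl g => 𝔐.holds α (.inl g) ∧ 𝔐.holds β (.inl g)
  | .meet α β, .inr m => ∀ g, 𝔐.holds α (.inl g) ∧ 𝔐.holds β (.inl g) → K.inc g m
  | .join α β, .inl g => ∀ m, 𝔐.holds α (.inr m) ∧ 𝔐.holds β (.inr m) → K.inc g m
  | .join α β, .inr m => 𝔐.holds α (.inr m) ∧ 𝔐.holds β (.inr m)
  | .neg α, .inl g => ¬ 𝔐.holds α (.inl g)
  | .neg α, .inr m => ∀ g, ¬ 𝔐.holds α (.inl g) → K.inc g m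
  | .opp α, .inl g => ∀ m, ¬ 𝔐.holds α (.inr m) → K.inc g m
  | .opp α, .inr m => ¬ 𝔐.holds α (.inr m)
  | .box α, .inl g => ∀ g₁, K.R g g₁ → 𝔐.holds α (.inl g₁)
  | .box α, .inr m => ∀ g, (∀ g₁, K.R g g₁ → 𝔐.holds α (.inl g₁)) → K.inc g m
  | .bbox α, .inl g => ∀ m, (∀ m₁, K.S m m₁ → 𝔐.holds α (.inr m₁)) → K.inc g m
  | .bbox α, .inr m => ∀ m₁, K.S m m₁ → 𝔐.holds α (.inr m₁)

/-- `𝔐, g ⊨ α`. -/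
def Model.Sat {K : KripkeContext.{u, v}} (𝔐 : Model K) (g : K.Obj) (α : Formula) : Prop :=
  𝔐.holds α (.inl g)

/-- `𝔐, m ≻ α`. -/
def Model.CoSat {K : KripkeContext.{u, v}} (𝔐 : Model K) (m : K.Prp) (α : Formula) : Prop :=
  𝔐.holds α (.inr m)

/-- Satisfaction of `α ⊔ β` at an object, in terms of co-satisfaction of `α ⊔ β` itself. -/
theorem Model.sat_join {K : KripkeContext.{u, v}} (𝔐 : Model K) (g : K.Obj) (α β : Formula) :
    𝔐.Sat g (α ⊔ᶠ β) ↔ ∀ m, 𝔐.CoSat m (α ⊔ᶠ β) → K.inc g m := Iff.rfl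

/-- Co-satisfaction of `α ⊓ β` at a property, in terms of satisfaction of `α ⊓ β` itself. -/
theorem Model.coSat_meet {K : KripkeContext.{u, v}} (𝔐 : Model K) (m : K.Prp) (α β : Formula) :
    𝔐.CoSat m (α ⊓ᶠ β) ↔ ∀ g, 𝔐.Sat g (α ⊓ᶠ β) → K.inc g m := Iff.rfl

/-- A sequent is satisfied in a model. -/
def Model.SatSequent {K : KripkeContext.{u, v}} (𝔐 : Model K) (s : Sequent) : Prop :=
  (∀ g, 𝔐.Sat g s.lhs → 𝔐.Sat g s.rhs) ∧ (∀ m, 𝔐.CoSat m s.rhs → 𝔐.CoSat m s.lhs)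

/-- An s-hypersequent is satisfied in a model if at least one of its components is. -/
def Model.SatHyper {K : KripkeContext.{u, v}} (𝔐 : Model K) (G : SHypersequent) : Prop :=
  ∃ s ∈ G, 𝔐.SatSequent s

/-- An s-hypersequent is true in a Kripke context if it is satisfied in every model based on it. -/
def KripkeContext.IsTrue (K : KripkeContext.{u, v}) (G : SHypersequent) : Prop :=
  ∀ 𝔐 : Model K, 𝔐.SatHyper G

/-- Validity in the class of all reflexive and transitive Kripke contexts. -/
def ValidRT (G : SHypersequent) : Prop :=
  ∀ K : KripkeContext.{u, v}, K.IsReflexive → K.IsTransitive → K.IsTrue G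

end MPDBL

/-! Soundness is an induction on derivations; its semantic input is that every formula denotes a
semiconcept (`Model.holds_polar`), so one of its two parts is the polar of the other.

Completeness uses one canonical model for all s-hypersequents. Any sequent satisfied there is
derivable on its own (`entails_of_canonicalModel_satSequent`), so a valid s-hypersequent has a
derivable component, and external weakening and exchange add the others.

The points of that model are primary filters and primary ideals of the derivability preorder. The
two sides are order duals, so `ModalSide` treats them once. The order is not Boolean: `a ≤ a ⊓ a`
can fail. It holds for meets, negations and boxes, and this suffices: prime separation
(`IsFilter.exists_primary`) works for any filter, and a principal up-set is a filter once its
generator is idempotent. The ideal need only be directed, since a principal down-set need not be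
closed under `⊔`. Separation from a primary ideal yields the polar clauses of the truth lemma
(`canonicalModel_holds`); separation from a principal ideal yields the box clauses and the final
comparison of formulae. -/

namespace MPDBL

/-! ### Soundness -/

section Soundness

variable {K : KripkeContext.{u, v}} (𝔐 : Model K)

/-- The object part and the property part of every formula form a semiconcept. -/
theorem Model.holds_polar (α : Formula) :
    (∀ m, 𝔐.holds α (.inr m) ↔ ∀ g, 𝔐.holds α (.inl g) → K.inc g m) ∨
      (∀ g, 𝔐.holds α (.inl g) ↔ ∀ m, 𝔐.holds α (.inr m) → K.inc g m) := by
  have key (x : Semiconcept K.toContext) : (∀ m, m ∈ x.intent ↔ ∀ g, g ∈ x.extent → K.inc g m) ∨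
      (∀ g, g ∈ x.extent ↔ ∀ m, m ∈ x.intent → K.inc g m) := by
    rcases x.polar_or with h | h
    · left; intro m; rw [← h]; rfl
    · right; intro g; rw [← h]; rfl
  cases α with
  | top => right; simp [Model.holds]
  | bot => left; simp [Model.holds]
  | ov p => exact key (𝔐.ov p)
  | pv P => exact key (𝔐.pv P)
  | join | opp | bbox => right; intro g; rfl
  | meet | neg | box => left; intro m; rfl

/-- Either half of the semiconcept condition puts extent × intent inside the incidence relation.
This handles axioms such as `□α ⊢ α`, where an arbitrary formula faces one whose other part is a
polar. -/
theorem Model.inc_of_holds {α : Formula} {g : K.Obj} {m : K.Prp}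
    (hg : 𝔐.holds α (.inl g)) (hm : 𝔐.holds α (.inr m)) : K.inc g m := by
  rcases 𝔐.holds_polar α with h | h
  · exact (h m).1 hm g hg
  · exact (h g).1 hg m hm

theorem Model.satSequent_mk (α β : Formula) : 𝔐.SatSequent (α ⊢ˢ β) ↔
    (∀ g, 𝔐.holds α (.inl g) → 𝔐.holds β (.inl g)) ∧
      (∀ m, 𝔐.holds β (.inr m) → 𝔐.holds α (.inr m)) := Iff.rfl

theorem Model.holds_ov_inr (p : ℕ) (m : K.Prp) :
    𝔐.holds (.ov p) (.inr m) ↔ ∀ g, 𝔐.holds (.ov p) (.inl g) → K.inc g m := by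
  have h := congrArg Semiconcept.intent (𝔐.ov_isLeft p)
  simp only [Semiconcept.meet, Set.inter_self] at h
  simp only [Model.holds]
  rw [← h]
  rfl

theorem Model.holds_pv_inl (P : ℕ) (g : K.Obj) :
    𝔐.holds (.pv P) (.inl g) ↔ ∀ m, 𝔐.holds (.pv P) (.inr m) → K.inc g m := by
  have h := congrArg Semiconcept.extent (𝔐.pv_isRight P)
  simp only [Semiconcept.join, Set.inter_self] at h
  simp only [Model.holds]
  rw [← h]
  rfl

theorem Model.satSequent_propAx {s : Sequent} (h : PropAx s) : 𝔐.SatSequent s := by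
  have inc {α : Formula} {g : K.Obj} {m : K.Prp} := 𝔐.inc_of_holds (α := α) (g := g) (m := m)
  cases h with
  | a14l α | a14r α =>
    rw [Model.satSequent_mk]
    -- Both sides denote the same formal concept: `(A′′, A′)` if `B = A′`, and `(B′, B′′)` if `A =
    -- B′`.
    rcases 𝔐.holds_polar α with h | h <;> simp only [Model.holds] <;> grind
  | a1 α => exact ⟨fun _ => id, fun _ => id⟩
  | a15al p => exact ⟨fun g hg => hg.1, fun m hm g hg => inc hg.1 hm⟩
  | a15ar p =>
    exact ⟨fun g hg => ⟨hg, hg⟩, fun m hm => (𝔐.holds_ov_inr p m).2 fun g hg => hm g ⟨hg, hg⟩⟩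
  | a15bl P =>
    exact ⟨fun g hg => (𝔐.holds_pv_inl P g).2 fun m hm => hg m ⟨hm, hm⟩, fun m hm => ⟨hm, hm⟩⟩
  | a15br P => exact ⟨fun g hg m hm => inc hg hm.1, fun m hm => hm.1⟩
  | _ =>
    rw [Model.satSequent_mk]
    simp only [Model.holds, Formula.vee, Formula.wedge]
    grind

theorem Model.satSequent_modalAx {s : Sequent} (h : ModalAx s) : 𝔐.SatSequent s := by
  cases h <;> rw [Model.satSequent_mk] <;> simp only [Model.holds] <;> grind

theorem Model.satSequent_fourAx (hr : K.IsReflexive) (ht : K.IsTransitive) {s : Sequent}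
    (h : FourAx s) : 𝔐.SatSequent s := by
  have inc {α : Formula} {g : K.Obj} {m : K.Prp} := 𝔐.inc_of_holds (α := α) (g := g) (m := m)
  obtain ⟨hR, hS⟩ := hr
  obtain ⟨tR, tS⟩ := ht
  cases h with
  | a19a α => exact ⟨fun g hg => hg g (hR g), fun m hm g hg => inc (hg g (hR g)) hm⟩
  | a19b α => exact ⟨fun g hg m hm => inc hg (hm m (hS m)), fun m hm => hm m (hS m)⟩
  | _ =>
    rw [Model.satSequent_mk]
    simp only [Model.holds]
    grind

theorem Model.satHyper_append (B C : SHypersequent) :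
    𝔐.SatHyper (B ++ C) ↔ 𝔐.SatHyper B ∨ 𝔐.SatHyper C := by
  simp only [Model.SatHyper, List.mem_append, or_and_right, exists_or]

theorem Model.satHyper_cons (s : Sequent) (C : SHypersequent) :
    𝔐.SatHyper (s :: C) ↔ 𝔐.SatSequent s ∨ 𝔐.SatHyper C := by
  simp [Model.SatHyper]

theorem Model.not_satHyper_nil : ¬ 𝔐.SatHyper [] := by
  simp [Model.SatHyper]

/-- A sequent that follows from another one in the model may replace it in an s-hypersequent. -/
theorem Model.satHyper_replace {B C : SHypersequent} {s t : Sequent}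
    (h : 𝔐.SatHyper (B ++ [s] ++ C)) (hst : 𝔐.SatSequent s → 𝔐.SatSequent t) :
    𝔐.SatHyper (B ++ [t] ++ C) := by
  simp only [Model.satHyper_append, Model.satHyper_cons, Model.not_satHyper_nil] at h ⊢
  tauto

theorem Model.satHyper_of_provable {T : Sequent → Prop} (hT : ∀ s, T s → 𝔐.SatSequent s)
    {G : SHypersequent} (h : Provable T G) : 𝔐.SatHyper G := by
  induction h with
  | propAx h => exact ⟨_, List.mem_singleton_self _, 𝔐.satSequent_propAx h⟩
  | modalAx h => exact ⟨_, List.mem_singleton_self _, 𝔐.satSequent_modalAx h⟩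
  | extraAx h => exact ⟨_, List.mem_singleton_self _, hT _ h⟩
  | r1 _ _ ih | r1' _ _ ih | r2 _ _ ih | r2' _ _ ih | r3 _ ih | r3' _ ih | r8 _ ih | r9 _ ih =>
    refine 𝔐.satHyper_replace ih ?_
    simp only [Model.satSequent_mk, Model.holds]
    grind
  | @r4 B C D E α β γ _ _ ih₁ ih₂ =>
    have : 𝔐.SatSequent (α ⊢ˢ β) → 𝔐.SatSequent (β ⊢ˢ γ) → 𝔐.SatSequent (α ⊢ˢ γ) :=
      fun h₁ h₂ => ⟨fun g hg => h₂.1 g (h₁.1 g hg), fun m hm => h₁.2 m (h₂.2 m hm)⟩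
    simp only [Model.satHyper_append, Model.satHyper_cons, Model.not_satHyper_nil] at ih₁ ih₂ ⊢
    grind
  | sp α =>
    simp only [Model.satHyper_cons, Model.not_satHyper_nil, Model.satSequent_mk, Model.holds]
    -- The two components match the two ways of being a semiconcept: `A′ = B` satisfies the first,
    -- `B′ = A` the second.
    rcases 𝔐.holds_polar α with h | h <;> grind
  | @r5 B C D E F G H X α β _ _ _ _ _ ih₂ ih₃ _ =>
    -- The meet comparison gives the object half of the conclusion, the join comparison the property
    -- half.
    have : 𝔐.SatSequent (α ⊓ᶠ α ⊢ˢ α ⊓ᶠ β) → 𝔐.SatSequent (α ⊔ᶠ β ⊢ˢ β ⊔ᶠ β) →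
        𝔐.SatSequent (α ⊢ˢ β) :=
      fun h₁ h₂ => ⟨fun g hg => (h₁.1 g ⟨hg, hg⟩).2, fun m hm => (h₂.2 m ⟨hm, hm⟩).1⟩
    simp only [Model.satHyper_append, Model.satHyper_cons, Model.not_satHyper_nil] at ih₂ ih₃ ⊢
    grind
  | ec _ ih | ee _ ih | ew _ ih =>
    simp only [Model.satHyper_append] at ih ⊢
    tauto

end Soundness

/-! ### Primary filters -/

/-- One side of a double Boolean algebra with an interior operator: the laws, with respect to a
preorder, of the meet, the negation, the box and the bounds. -/
structure ModalSide (X : Type*) where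
  le : X → X → Prop
  meet : X → X → X
  neg : X → X
  box : X → X
  top : X
  bot : X
  le_refl (a) : le a a
  le_trans {a b c} : le a b → le b c → le a c
  meet_le_left (a b) : le (meet a b) a
  meet_le_right (a b) : le (meet a b) b
  meet_mono {a b c d} : le a b → le c d → le (meet a c) (meet b d)
  meet_le_idem (a b) : le (meet a b) (meet (meet a b) (meet a b))
  neg_anti {a b} : le a b → le (neg b) (neg a)
  neg_meet_self_le (a) : le (neg (meet a a)) (neg a)
  neg_neg_meet_le (a b) : le (neg (neg (meet a b))) (meet a b)
  distrib (a b c) : le (meet a (neg (meet (neg b) (neg c))))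
    (neg (meet (neg (meet a b)) (neg (meet a c))))
  bot_le (a) : le bot a
  le_top (a) : le a top
  meet_neg_le (a) : le (meet a (neg a)) bot
  top_meet_top_le : le (meet top top) (neg bot)
  box_mono {a b} : le a b → le (box a) (box b)
  box_meet_le (a b) : le (meet (box a) (box b)) (box (meet a b))
  le_box_meet (a b) : le (box (meet a b)) (meet (box a) (box b))
  le_box_neg_bot : le (neg bot) (box (neg bot))
  box_le_box_meet_self (a) : le (box a) (box (meet a a))
  box_le (a) : le (box a) a
  box_le_box_box (a) : le (box a) (box (box a))

namespace ModalSide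

variable {X : Type*} (D : ModalSide X)

/-! ### Idempotents and case distinction -/

theorem neg_neg_le_meet (a : X) : D.le (D.neg (D.neg a)) (D.meet a a) :=
  D.le_trans (D.neg_anti (D.neg_meet_self_le a)) (D.neg_neg_meet_le a a)

theorem neg_neg_le (a : X) : D.le (D.neg (D.neg a)) a :=
  D.le_trans (D.neg_neg_le_meet a) (D.meet_le_left a a)

/-- Pass through the triple negation: `¬a ≤ ¬¬¬a` by antitonicity, and a double negation lies below
the square of its argument. -/
theorem neg_le_idem (a : X) : D.le (D.neg a) (D.meet (D.neg a) (D.neg a)) :=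
  D.le_trans (D.neg_anti (D.neg_neg_le a)) (D.neg_neg_le_meet (D.neg a))

theorem box_le_idem (a : X) : D.le (D.box a) (D.meet (D.box a) (D.box a)) :=
  D.le_trans (D.box_le_box_meet_self a) (D.le_box_meet a a)

/-- Idempotence of `¬c` gives `¬c ≤ ¬a ⊓ ¬b`; negate and use `¬¬c ≤ c`. -/
theorem vee_le {a b c : X} (ha : D.le a c) (hb : D.le b c) :
    D.le (D.neg (D.meet (D.neg a) (D.neg b))) c :=
  D.le_trans (D.neg_anti (D.le_trans (D.neg_le_idem c)
    (D.meet_mono (D.neg_anti ha) (D.neg_anti hb)))) (D.neg_neg_le c)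

theorem meet_self_le_vee_neg (f x : X) :
    D.le (D.meet f f) (D.neg (D.meet (D.neg x) (D.neg (D.neg x)))) :=
  D.le_trans (D.meet_mono (D.le_top f) (D.le_top f)) <|
    D.le_trans D.top_meet_top_le <| D.neg_anti <| D.meet_neg_le _

/-- Case distinction on an element and its negation. -/
theorem meet_self_le_of_cases {f x c : X} (h₁ : D.le (D.meet f x) c)
    (h₂ : D.le (D.meet f (D.neg x)) c) : D.le (D.meet f f) c :=
  D.le_trans (D.meet_le_idem f f) <|
    D.le_trans (D.meet_mono (D.meet_le_left f f) (D.meet_self_le_vee_neg f x)) <|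
      D.le_trans (D.distrib f x (D.neg x)) (D.vee_le h₁ h₂)

/-- Nonempty up-closed sets that are closed under the meet. -/
structure IsFilter (F : Set X) : Prop where
  nonempty : F.Nonempty
  mem_of_le : ∀ {a b}, a ∈ F → D.le a b → b ∈ F
  meet_mem : ∀ {a b}, a ∈ F → b ∈ F → D.meet a b ∈ F

/-- Nonempty down-closed directed sets. -/
structure IsDirectedIdeal (I : Set X) : Prop where
  nonempty : I.Nonempty
  mem_of_le : ∀ {a b}, b ∈ I → D.le a b → a ∈ I
  directed : ∀ {a b}, a ∈ I → b ∈ I → ∃ c ∈ I, D.le a c ∧ D.le b c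

/-- Proper filters that contain each element or its negation. -/
structure IsPrimary (F : Set X) : Prop extends D.IsFilter F where
  bot_notMem : D.bot ∉ F
  mem_or_neg_mem : ∀ a, a ∈ F ∨ D.neg a ∈ F

variable {D}

theorem IsPrimary.neg_mem_iff {F : Set X} (hF : D.IsPrimary F) {a : X} :
    D.neg a ∈ F ↔ a ∉ F :=
  ⟨fun h h' => hF.bot_notMem (hF.mem_of_le (hF.meet_mem h' h) (D.meet_neg_le a)),
    fun h => (hF.mem_or_neg_mem a).resolve_left h⟩

theorem IsFilter.meet_mem_iff {F : Set X} (hF : D.IsFilter F) {a b : X} :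
    D.meet a b ∈ F ↔ a ∈ F ∧ b ∈ F :=
  ⟨fun h => ⟨hF.mem_of_le h (D.meet_le_left a b), hF.mem_of_le h (D.meet_le_right a b)⟩,
    fun h => hF.meet_mem h.1 h.2⟩

theorem IsFilter.top_mem {F : Set X} (hF : D.IsFilter F) : D.top ∈ F :=
  hF.nonempty.elim fun _ h => hF.mem_of_le h (D.le_top _)

/-- Idempotence is what closes the up-set under meets: `a ≤ a ⊓ a ≤ b ⊓ c`. -/
theorem isFilter_principal {a : X} (h : D.le a (D.meet a a)) : D.IsFilter {y | D.le a y} where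
  nonempty := ⟨a, D.le_refl a⟩
  mem_of_le hb hbc := D.le_trans hb hbc
  meet_mem hb hc := D.le_trans h (D.meet_mono hb hc)

theorem isDirectedIdeal_principal (a : X) : D.IsDirectedIdeal {y | D.le y a} where
  nonempty := ⟨a, D.le_refl a⟩
  mem_of_le hb hbc := D.le_trans hbc hb
  directed hb hc := ⟨a, D.le_refl a, hb, hc⟩

/-- The generators `f ⊓ x` are meets, hence idempotent, so `x` itself may be arbitrary. -/
theorem IsFilter.adjoin {F : Set X} (hF : D.IsFilter F) (x : X) :
    D.IsFilter {y | ∃ f ∈ F, D.le (D.meet f x) y} where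
  nonempty := hF.nonempty.elim fun f hf => ⟨_, f, hf, D.le_refl _⟩
  mem_of_le := fun ⟨f, hf, h⟩ h' => ⟨f, hf, D.le_trans h h'⟩
  meet_mem := fun ⟨f, hf, h⟩ ⟨g, hg, h'⟩ => ⟨D.meet f g, hF.meet_mem hf hg,
    D.le_trans (D.meet_le_idem _ _) (D.meet_mono
      (D.le_trans (D.meet_mono (D.meet_le_left _ _) (D.le_refl _)) h)
      (D.le_trans (D.meet_mono (D.meet_le_right _ _) (D.le_refl _)) h'))⟩

/-- A filter that is disjoint from a directed ideal extends to a primary filter that is. -/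
theorem IsFilter.exists_primary {F I : Set X} (hF : D.IsFilter F) (hI : D.IsDirectedIdeal I)
    (hFI : Disjoint F I) : ∃ U, D.IsPrimary U ∧ F ⊆ U ∧ Disjoint U I := by
  have hub : ∀ c ⊆ {U | D.IsFilter U ∧ Disjoint U I}, IsChain (· ⊆ ·) c → c.Nonempty →
      ⋃₀ c ∈ {U | D.IsFilter U ∧ Disjoint U I} := by
    intro c hc hchain hne
    refine ⟨⟨?_, ?_, ?_⟩, Set.disjoint_sUnion_left.2 fun s hs => (hc hs).2⟩
    · obtain ⟨s, hs⟩ := hne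
      obtain ⟨a, ha⟩ := (hc hs).1.nonempty
      exact ⟨a, s, hs, ha⟩
    · rintro a b ⟨s, hs, ha⟩ hab
      exact ⟨s, hs, (hc hs).1.mem_of_le ha hab⟩
    · rintro a b ⟨s, hs, ha⟩ ⟨t, ht, hb⟩
      rcases hchain.total hs ht with h | h
      · exact ⟨t, ht, (hc ht).1.meet_mem (h ha) hb⟩
      · exact ⟨s, hs, (hc hs).1.meet_mem ha (h hb)⟩
  obtain ⟨U, hFU, hU⟩ := zorn_subset_nonempty {U | D.IsFilter U ∧ Disjoint U I}
    (fun c hc hchain hne => ⟨⋃₀ c, hub c hc hchain hne,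
      fun s hs => Set.subset_sUnion_of_mem hs⟩) F ⟨hF, hFI⟩
  obtain ⟨hUf, hUI⟩ := hU.prop
  -- By maximality of `U`, adjoining an outside element must produce a filter that hits `I`.
  have key (x : X) (hx : x ∉ U) : ∃ f ∈ U, D.meet f x ∈ I := by
    by_contra! hcon
    refine hx (hU.le_of_ge ⟨hUf.adjoin x, ?_⟩ ?_ ?_)
    · rw [Set.disjoint_left]
      rintro y ⟨f, hf, hfy⟩ hy
      exact hcon f hf (hI.mem_of_le hy hfy)
    · exact fun f hf => ⟨f, hf, D.meet_le_left f x⟩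
    · exact hUf.nonempty.elim fun f hf => ⟨f, hf, D.meet_le_right f x⟩
  refine ⟨U, ⟨hUf, ?_, ?_⟩, hFU, hUI⟩
  · exact hI.nonempty.elim fun i hi h =>
      Set.disjoint_left.1 hUI h (hI.mem_of_le hi (D.bot_le i))
  · by_contra! ⟨x, hx, hnx⟩
    obtain ⟨f, hf, hfx⟩ := key x hx
    obtain ⟨g, hg, hgx⟩ := key _ hnx
    -- Directedness provides one bound `c` in `I` for both cases. The case distinction over `f ⊓ g`
    -- bounds only its square, which is still in `U`.
    obtain ⟨c, hc, h₁, h₂⟩ := hI.directed hfx hgx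
    have hfg := hUf.meet_mem hf hg
    refine Set.disjoint_left.1 hUI (hUf.mem_of_le (hUf.meet_mem hfg hfg)
      (D.meet_self_le_of_cases (x := x) ?_ ?_)) hc
    · exact D.le_trans (D.meet_mono (D.meet_le_left f g) (D.le_refl x)) h₁
    · exact D.le_trans (D.meet_mono (D.meet_le_right f g) (D.le_refl _)) h₂

theorem exists_primary_separating {a b : X} (ha : D.le a (D.meet a a)) (h : ¬ D.le a b) :
    ∃ U, D.IsPrimary U ∧ a ∈ U ∧ b ∉ U := by
  obtain ⟨U, hU, haU, hUb⟩ := (isFilter_principal ha).exists_primary (isDirectedIdeal_principal b)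
    (Set.disjoint_left.2 fun y hy hy' => h (D.le_trans hy hy'))
  exact ⟨U, hU, haU (D.le_refl a), fun hb => Set.disjoint_left.1 hUb hb (D.le_refl b)⟩

/-- An idempotent belongs to a directed ideal if every primary filter that contains it meets the
ideal. -/
theorem IsDirectedIdeal.mem_iff {I : Set X} (hI : D.IsDirectedIdeal I) {a : X}
    (ha : D.le a (D.meet a a)) :
    a ∈ I ↔ ∀ F, D.IsPrimary F → a ∈ F → (F ∩ I).Nonempty := by
  refine ⟨fun h F _ haF => ⟨a, haF, h⟩, fun h => ?_⟩
  by_contra haI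
  obtain ⟨U, hU, haU, hUI⟩ := (isFilter_principal ha).exists_primary hI
    (Set.disjoint_left.2 fun y hy hy' => haI (hI.mem_of_le hy' hy))
  exact Set.not_disjoint_iff_nonempty_inter.2 (h U hU (haU (D.le_refl a))) hUI

variable (D) in
/-- The canonical accessibility relation. -/
def Rel (F F₁ : Set X) : Prop := ∀ a, D.box a ∈ F → a ∈ F₁

theorem IsPrimary.rel_refl {F : Set X} (hF : D.IsPrimary F) : D.Rel F F :=
  fun a h => hF.mem_of_le h (D.box_le a)

theorem IsPrimary.rel_trans {F F₁ F₂ : Set X} (hF : D.IsPrimary F) (h₁ : D.Rel F F₁)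
    (h₂ : D.Rel F₁ F₂) : D.Rel F F₂ :=
  fun a h => h₂ a (h₁ _ (hF.mem_of_le h (D.box_le_box_box a)))

theorem IsPrimary.box_mem_iff {F : Set X} (hF : D.IsPrimary F) {a : X} :
    D.box a ∈ F ↔ ∀ F₁, D.IsPrimary F₁ → D.Rel F F₁ → a ∈ F₁ := by
  refine ⟨fun h F₁ _ hR => hR a h, fun h => ?_⟩
  by_contra ha
  -- A primary filter containing this set is by definition an accessible point; monotonicity of the
  -- box keeps the set disjoint from the down-set of `a`.
  have hF₀ : D.IsFilter {y | D.box y ∈ F} :=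
    { nonempty := ⟨D.neg D.bot, hF.mem_of_le (hF.neg_mem_iff.2 hF.bot_notMem) D.le_box_neg_bot⟩
      mem_of_le := fun hb hbc => hF.mem_of_le hb (D.box_mono hbc)
      meet_mem := fun hb hc => hF.mem_of_le (hF.meet_mem hb hc) (D.box_meet_le _ _) }
  obtain ⟨U, hU, hFU, hUa⟩ := hF₀.exists_primary (isDirectedIdeal_principal a)
    (Set.disjoint_left.2 fun y hy hy' => ha (hF.mem_of_le hy (D.box_mono hy')))
  exact Set.disjoint_left.1 hUa (h U hU hFU) (D.le_refl a)

end ModalSide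

/-! ### The canonical model -/

/-- Derivability of a single sequent. -/
def Entails (α β : Formula) : Prop := ProvableMPDBL4 [α ⊢ˢ β]

namespace Entails

theorem prop {α β : Formula} (h : PropAx (α ⊢ˢ β)) : Entails α β := Provable.propAx h

theorem modal {α β : Formula} (h : ModalAx (α ⊢ˢ β)) : Entails α β := Provable.modalAx h

theorem four {α β : Formula} (h : FourAx (α ⊢ˢ β)) : Entails α β := Provable.extraAx h

theorem trans {α β γ : Formula} (h₁ : Entails α β) (h₂ : Entails β γ) : Entails α γ :=
  Provable.r4 (B := []) (C := []) (D := []) (E := []) h₁ h₂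

theorem meet_mono {α β γ δ : Formula} (h₁ : Entails α β) (h₂ : Entails γ δ) :
    Entails (α ⊓ᶠ γ) (β ⊓ᶠ δ) :=
  trans (Provable.r1 (B := []) (C := []) γ h₁) (Provable.r1' (B := []) (C := []) β h₂)

theorem join_mono {α β γ δ : Formula} (h₁ : Entails α β) (h₂ : Entails γ δ) :
    Entails (α ⊔ᶠ γ) (β ⊔ᶠ δ) :=
  trans (Provable.r2 (B := []) (C := []) γ h₁) (Provable.r2' (B := []) (C := []) β h₂)

/-- The other two premises of the rule, `α ⊓ β ⊢ α ⊓ α` and `β ⊔ β ⊢ α ⊔ β`, are always derivable.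
-/
theorem of_meet_of_join {α β : Formula} (h₁ : Entails (α ⊓ᶠ α) (α ⊓ᶠ β))
    (h₂ : Entails (α ⊔ᶠ β) (β ⊔ᶠ β)) : Entails α β :=
  Provable.r5 (B := []) (C := []) (D := []) (E := []) (F := []) (G := []) (H := []) (X := [])
    (trans (prop (.a4a α β)) (meet_mono (prop (.a2a α β)) (prop (.a2a α β)))) h₁ h₂
    (trans (join_mono (prop (.a3b α β)) (prop (.a3b α β))) (prop (.a4b α β)))

end Entails

/-- The side of the objects. -/
def objSide : ModalSide Formula where
  le := Entails
  meet := .meet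
  neg := .neg
  box := .box
  top := .top
  bot := .bot
  le_refl a := .prop (.a1 a)
  le_trans := .trans
  meet_le_left a b := .prop (.a2a a b)
  meet_le_right a b := .prop (.a3a a b)
  meet_mono := .meet_mono
  meet_le_idem a b := .prop (.a4a a b)
  neg_anti h := Provable.r3 (B := []) (C := []) h
  neg_meet_self_le a := .prop (.a5a a)
  neg_neg_meet_le a b := .prop (.a7al a b)
  distrib a b c := .prop (.a10al a b c)
  bot_le a := .prop (.a11a a)
  le_top a := .prop (.a11b a)
  meet_neg_le a := .prop (.a6a a)
  top_meet_top_le := .prop .a13ar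
  box_mono h := Provable.r8 (B := []) (C := []) h
  box_meet_le a b := .modal (.a16al a b)
  le_box_meet a b := .modal (.a16ar a b)
  le_box_neg_bot := .modal .a17ar
  box_le_box_meet_self a := .modal (.a18ar a)
  box_le a := .four (.a19a a)
  box_le_box_box a := .four (.a20ar a)

/-- The side of the properties, where the order is reversed. -/
def prpSide : ModalSide Formula where
  le a b := Entails b a
  meet := .join
  neg := .opp
  box := .bbox
  top := .bot
  bot := .top
  le_refl a := .prop (.a1 a)
  le_trans h₁ h₂ := .trans h₂ h₁
  meet_le_left a b := .prop (.a2b a b)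
  meet_le_right a b := .prop (.a3b a b)
  meet_mono := .join_mono
  meet_le_idem a b := .prop (.a4b a b)
  neg_anti h := Provable.r3' (B := []) (C := []) h
  neg_meet_self_le a := .prop (.a5b a)
  neg_neg_meet_le a b := .prop (.a7br a b)
  distrib a b c := .prop (.a10br a b c)
  bot_le a := .prop (.a11b a)
  le_top a := .prop (.a11a a)
  meet_neg_le a := .prop (.a6b a)
  top_meet_top_le := .prop .a13bl
  box_mono h := Provable.r9 (B := []) (C := []) h
  box_meet_le a b := .modal (.a16br a b)
  le_box_meet a b := .modal (.a16bl a b)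
  le_box_neg_bot := .modal .a17bl
  box_le_box_meet_self a := .modal (.a18bl a)
  box_le a := .four (.a19b a)
  box_le_box_box a := .four (.a20bl a)

/-- The join of two members is an upper bound in the derivability order; it need not be a least one.
-/
theorem isDirectedIdeal_of_prpSide {I : Set Formula} (hI : prpSide.IsFilter I) :
    objSide.IsDirectedIdeal I where
  nonempty := hI.nonempty
  mem_of_le hb h := hI.mem_of_le hb h
  directed ha hb := ⟨_, hI.meet_mem ha hb, prpSide.meet_le_left _ _, prpSide.meet_le_right _ _⟩

theorem isDirectedIdeal_of_objSide {F : Set Formula} (hF : objSide.IsFilter F) :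
    prpSide.IsDirectedIdeal F where
  nonempty := hF.nonempty
  mem_of_le hb h := hF.mem_of_le hb h
  directed ha hb := ⟨_, hF.meet_mem ha hb, objSide.meet_le_left _ _, objSide.meet_le_right _ _⟩

/-- The canonical Kripke context: primary filters and primary ideals, incident if they meet. -/
def canonicalContext : KripkeContext.{u, v} where
  -- Sets of formulae live in the lowest universe; lifting reaches arbitrary `u` and `v`.
  Obj := ULift {F : Set Formula // objSide.IsPrimary F}
  Prp := ULift {I : Set Formula // prpSide.IsPrimary I}
  inc F I := (F.down.1 ∩ I.down.1).Nonempty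
  R F F₁ := objSide.Rel F.down.1 F₁.down.1
  S I I₁ := prpSide.Rel I.down.1 I₁.down.1

theorem canonicalContext_isReflexive : canonicalContext.{u, v}.IsReflexive :=
  ⟨fun F => F.down.2.rel_refl, fun I => I.down.2.rel_refl⟩

theorem canonicalContext_isTransitive : canonicalContext.{u, v}.IsTransitive :=
  ⟨fun F _ _ => F.down.2.rel_trans, fun I _ _ => I.down.2.rel_trans⟩

/-- Separation of the up-set of `α` from the ideal `I`; this matches the polar clause for
co-satisfaction of `⊓`, `¬` and `□`. -/
theorem mem_prp_iff {α : Formula} (h : Entails α (α ⊓ᶠ α)) (I : canonicalContext.{u, v}.Prp) :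
    α ∈ I.down.1 ↔ ∀ F : canonicalContext.{u, v}.Obj, α ∈ F.down.1 → canonicalContext.inc F I :=
  ((isDirectedIdeal_of_prpSide I.down.2.toIsFilter).mem_iff h).trans
    ⟨fun H F => H _ F.down.2, fun H F hF => H ⟨F, hF⟩⟩

theorem mem_obj_iff {α : Formula} (h : Entails (α ⊔ᶠ α) α) (F : canonicalContext.{u, v}.Obj) :
    α ∈ F.down.1 ↔ ∀ I : canonicalContext.{u, v}.Prp, α ∈ I.down.1 → canonicalContext.inc F I :=
  ((isDirectedIdeal_of_objSide F.down.2.toIsFilter).mem_iff h).trans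
    ⟨fun H I hI => (H _ I.down.2 hI).mono fun _ h => h.symm,
      fun H I hI h => (H ⟨⟨I, hI⟩⟩ h).mono fun _ h => h.symm⟩

/-- The semiconcept of a formula that is idempotent for the meet. -/
def leftConcept (α : Formula) (h : Entails α (α ⊓ᶠ α)) :
    Semiconcept canonicalContext.{u, v}.toContext where
  extent := {F | α ∈ F.down.1}
  intent := {I | α ∈ I.down.1}
  polar_or := .inl <| Set.ext fun I => (mem_prp_iff h I).symm

/-- The semiconcept of a formula that is idempotent for the join. -/
def rightConcept (α : Formula) (h : Entails (α ⊔ᶠ α) α) :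
    Semiconcept canonicalContext.{u, v}.toContext where
  extent := {F | α ∈ F.down.1}
  intent := {I | α ∈ I.down.1}
  polar_or := .inr <| Set.ext fun F => (mem_obj_iff h F).symm

/-- The canonical model. -/
def canonicalModel : Model canonicalContext.{u, v} where
  ov p := leftConcept (.ov p) (.prop (.a15ar p))
  pv P := rightConcept (.pv P) (.prop (.a15bl P))
  ov_isLeft p := by
    refine Semiconcept.ext (Set.inter_self _) ?_
    simp only [Semiconcept.meet, Set.inter_self]
    exact Set.ext fun I => (mem_prp_iff (.prop (.a15ar p)) I).symm
  pv_isRight P := by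
    refine Semiconcept.ext ?_ (Set.inter_self _)
    simp only [Semiconcept.join, Set.inter_self]
    exact Set.ext fun F => (mem_obj_iff (.prop (.a15bl P)) F).symm

/-- The truth lemma. -/
theorem canonicalModel_holds (α : Formula) :
    (∀ F, canonicalModel.{u, v}.holds α (.inl F) ↔ α ∈ F.down.1) ∧
      ∀ I, canonicalModel.{u, v}.holds α (.inr I) ↔ α ∈ I.down.1 := by
  -- For `⊓`, `¬` and `□` only the object half needs the connective: idempotence transfers it to
  -- properties. Dually below for `⊔`, `⌟` and `■`.
  have left {α : Formula} (h : Entails α (α ⊓ᶠ α))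
      (hp : ∀ I, canonicalModel.{u, v}.holds α (.inr I) ↔
        ∀ F, canonicalModel.{u, v}.holds α (.inl F) → canonicalContext.inc F I)
      (ho : ∀ F, canonicalModel.{u, v}.holds α (.inl F) ↔ α ∈ F.down.1) :
      (∀ F, canonicalModel.{u, v}.holds α (.inl F) ↔ α ∈ F.down.1) ∧
        ∀ I, canonicalModel.{u, v}.holds α (.inr I) ↔ α ∈ I.down.1 := by
    refine ⟨ho, fun I => (hp I).trans ?_⟩
    simp only [ho]
    exact (mem_prp_iff h I).symm
  have right {α : Formula} (h : Entails (α ⊔ᶠ α) α)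
      (ho : ∀ F, canonicalModel.{u, v}.holds α (.inl F) ↔
        ∀ I, canonicalModel.{u, v}.holds α (.inr I) → canonicalContext.inc F I)
      (hp : ∀ I, canonicalModel.{u, v}.holds α (.inr I) ↔ α ∈ I.down.1) :
      (∀ F, canonicalModel.{u, v}.holds α (.inl F) ↔ α ∈ F.down.1) ∧
        ∀ I, canonicalModel.{u, v}.holds α (.inr I) ↔ α ∈ I.down.1 := by
    refine ⟨fun F => (ho F).trans ?_, hp⟩
    simp only [hp]
    exact (mem_obj_iff h F).symm
  induction α with
  | top => exact ⟨fun F => iff_of_true trivial F.down.2.top_mem,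
      fun I => iff_of_false id I.down.2.bot_notMem⟩
  | bot => exact ⟨fun F => iff_of_false id F.down.2.bot_notMem,
      fun I => iff_of_true trivial I.down.2.top_mem⟩
  | ov p => exact ⟨fun F => Iff.rfl, fun I => Iff.rfl⟩
  | pv P => exact ⟨fun F => Iff.rfl, fun I => Iff.rfl⟩
  | meet α β ihα ihβ =>
    exact left (objSide.meet_le_idem α β) (fun I => Iff.rfl) fun F =>
      (and_congr (ihα.1 F) (ihβ.1 F)).trans F.down.2.meet_mem_iff.symm
  | join α β ihα ihβ =>
    exact right (prpSide.meet_le_idem α β) (fun F => Iff.rfl) fun I =>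
      (and_congr (ihα.2 I) (ihβ.2 I)).trans I.down.2.meet_mem_iff.symm
  | neg α ih =>
    exact left (objSide.neg_le_idem α) (fun I => Iff.rfl) fun F =>
      (not_congr (ih.1 F)).trans F.down.2.neg_mem_iff.symm
  | opp α ih =>
    exact right (prpSide.neg_le_idem α) (fun F => Iff.rfl) fun I =>
      (not_congr (ih.2 I)).trans I.down.2.neg_mem_iff.symm
  | box α ih =>
    refine left (objSide.box_le_idem α) (fun I => Iff.rfl) fun F => ?_
    exact Iff.trans ⟨fun H F₁ hF₁ hR => (ih.1 ⟨F₁, hF₁⟩).1 (H _ hR),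
      fun H F₁ hR => (ih.1 F₁).2 (H _ F₁.down.2 hR)⟩ F.down.2.box_mem_iff.symm
  | bbox α ih =>
    refine right (prpSide.box_le_idem α) (fun F => Iff.rfl) fun I => ?_
    exact Iff.trans ⟨fun H I₁ hI₁ hS => (ih.2 ⟨I₁, hI₁⟩).1 (H _ hS),
      fun H I₁ hS => (ih.2 I₁).2 (H _ I₁.down.2 hS)⟩ I.down.2.box_mem_iff.symm

/-! ### Completeness -/

theorem entails_of_canonicalModel_satSequent {α β : Formula}
    (h : canonicalModel.{u, v}.SatSequent (α ⊢ˢ β)) : Entails α β := by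
  obtain ⟨h₁, h₂⟩ := h
  -- `α` and `β` need not be idempotent, but `α ⊓ α` and `β ⊔ β` are, on their respective sides, so
  -- each failing comparison is witnessed by a point.
  refine .of_meet_of_join ?_ ?_ <;> by_contra hcon
  · obtain ⟨F, hF, hα, hβ⟩ :=
      ModalSide.exists_primary_separating (objSide.meet_le_idem α α) hcon
    have hα := (hF.meet_mem_iff.1 hα).1
    exact hβ (hF.meet_mem hα
      (((canonicalModel_holds β).1 ⟨F, hF⟩).1
        (h₁ ⟨F, hF⟩ (((canonicalModel_holds α).1 ⟨F, hF⟩).2 hα))))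
  · obtain ⟨I, hI, hβ, hα⟩ :=
      ModalSide.exists_primary_separating (D := prpSide) (prpSide.meet_le_idem β β) hcon
    have hβ := (hI.meet_mem_iff.1 hβ).1
    exact hα (hI.meet_mem (((canonicalModel_holds α).2 ⟨I, hI⟩).1
        (h₂ ⟨I, hI⟩ (((canonicalModel_holds β).2 ⟨I, hI⟩).2 hβ))) hβ)

theorem Provable.of_mem {T : Sequent → Prop} {s : Sequent} {G : SHypersequent}
    (h : Provable T [s]) (hs : s ∈ G) : Provable T G := by
  obtain ⟨B, C, rfl⟩ := List.append_of_mem hs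
  -- Weakening adds components only on the right, so `s` starts in front and is then exchanged with
  -- `B`.
  have h' : Provable T ([] ++ [s] ++ B ++ C) := by simpa using h.ew (C := B ++ C)
  simpa using h'.ee

end MPDBL

theorem mainTheorem5 (G : MPDBL.SHypersequent) :
    MPDBL.ProvableMPDBL4 G ↔ MPDBL.ValidRT.{u, v} G := by
  refine ⟨fun h K hr ht 𝔐 => 𝔐.satHyper_of_provable (fun s => 𝔐.satSequent_fourAx hr ht) h,
    fun h => ?_⟩
  obtain ⟨s, hs, hsat⟩ := h MPDBL.canonicalContext MPDBL.canonicalContext_isReflexive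
    MPDBL.canonicalContext_isTransitive MPDBL.canonicalModel
  exact (MPDBL.entails_of_canonicalModel_satSequent hsat).of_mem hs
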